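/- **Proposition 4.1.** Let $n \ge 1$, let $\eta_1,\dots,\eta_n \ge 0$ (learning rates), $C > 0$ (clipping constant) and $\sigma_1,\dots,\sigma_n \in \mathbb{R}$ (noise multipliers), and assume that $\sum_{j=k}^n \sigma_j^2 > 0$ for every $k$ with $\eta_k > 0$. One-pass DP-GD takes a dataset $D = ((x_1,y_1),\dots,(x_n,y_n))$ with $x_k \in \mathbb{R}^d$, $y_k \in \mathbb{R}$, starts at $\theta_0 = 0$, and for $k = 1,\dots,n$ computes $$g_k = x_k\,(x_k^\top\theta_{k-1} - y_k),\qquad \bar g_k = g_k \min\Big(1, \frac{C}{\|g_k\|_2}\Big),\qquad \bar\eta_k = \min\Big(\eta_k, \frac{2}{\|x_k\|_2^2}\Big),$$ $$\theta_k = \theta_{k-1} - \bar\eta_k\,\bar g_k + 2 C \sigma_k b_k,$$ where $b_1,\dots,b_n \sim \mathcal{N}(0, I_d)$ are independent (with $\bar g_k = 0$ if $g_k = 0$, and $2/0 = +\infty$). Its output is $\mathcal{A}(D) = \theta_n$. Then $\mathcal{A}$ satisfies $(\rho^2/2)$-zero concentrated differential privacy with $$\rho = \max_{1 \le k \le n}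 \frac{\eta_k}{\sqrt{\sum_{j=k}^n \sigma_j^2}} \qquad (\text{with } 0/0 = 0).$$ That is, for any two datasets $D, D'$ of $n$ samples which differ in at most one sample and every $\alpha \in (1,\infty)$, $$D_\alpha\big(\mathcal{A}(D)\,\|\,\mathcal{A}(D')\big) \le \alpha\,\frac{\rho^2}{2},$$ where $D_\alpha(\mu\,\|\,\nu) = \frac{1}{\alpha-1}\ln\int \big(\frac{d\mu}{d\nu}\big)^\alpha d\nu$ is the Rényi divergence of the laws (equal to $+\infty$ if $\mu \not\ll \nu$). -/

import Mathlib

namespace DPGD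

open MeasureTheory ProbabilityTheory

/-- The Rényi divergence `D_α(μ ‖ ν) = (α - 1)⁻¹ log ∫ (dμ/dν)^α dν` of order `α > 1`, with values in
the extended reals; it is `+∞` when `μ` is not absolutely continuous with respect to `ν`. If `μ` and
`ν` have densities `p` and `q` with respect to some reference measure, then `dμ/dν = p / q`. -/
noncomputable def renyiDiv {Θ : Type*} [MeasurableSpace Θ] (α : ℝ) (μ ν : Measure Θ) : EReal :=
  open Classical in
  if μ ≪ ν then
    ((1 / (α - 1) : ℝ) : EReal) * ENNReal.log (∫⁻ t, (μ.rnDeriv ν t) ^ α ∂ν)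
  else ⊤

/-- Two datasets of `n` samples are adjacent if they differ in at most one sample. -/
def Adjacent {n : ℕ} {S : Type*} (D D' : Fin n → S) : Prop :=
  ∃ i, ∀ j, j ≠ i → D j = D' j

/-- A randomized algorithm, given by the law `A D` of its output on each dataset `D`, satisfies
`ξ`-zero concentrated differential privacy. -/
def IsZCDP {n : ℕ} {S Θ : Type*} [MeasurableSpace Θ] (A : (Fin n → S) → Measure Θ) (ξ : ℝ) : Prop :=
  ∀ D D' : Fin n → S, Adjacent D D' →
    ∀ α : ℝ, 1 < α → renyiDiv α (A D) (A D') ≤ ((ξ * α : ℝ) : EReal)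

/-- The gradient `x (xᵀθ - y)` of `θ ↦ (xᵀθ - y)² / 2`. -/
noncomputable def grad {d : ℕ} (x : EuclideanSpace ℝ (Fin d)) (y : ℝ)
    (θ : EuclideanSpace ℝ (Fin d)) : EuclideanSpace ℝ (Fin d) :=
  (inner ℝ x θ - y) • x

/-- Clipping: `g min(1, C / ‖g‖)`. At `g = 0` the value is `0`, whatever `C / 0` is. -/
noncomputable def clip {d : ℕ} (C : ℝ) (g : EuclideanSpace ℝ (Fin d)) :
    EuclideanSpace ℝ (Fin d) :=
  min 1 (C / ‖g‖) • g

/-- The adaptive learning rate `min(η, 2 / ‖x‖²)`, where `2 / ‖x‖²` is read as `+∞` if `x = 0`. -/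
noncomputable def adaptiveRate {d : ℕ} (η : ℝ) (x : EuclideanSpace ℝ (Fin d)) : ℝ :=
  open Classical in
  if x = 0 then η else min η (2 / ‖x‖ ^ 2)

/-- One iteration of DP-GD at the parameter `θ`, on the sample `s = (x, y)` and with the realization
`b` of the noise. -/
noncomputable def step {d : ℕ} (η C σ : ℝ) (s : EuclideanSpace ℝ (Fin d) × ℝ)
    (θ b : EuclideanSpace ℝ (Fin d)) : EuclideanSpace ℝ (Fin d) :=
  θ - adaptiveRate η s.1 • clip C (grad s.1 s.2 θ) + (2 * C * σ) • b

/-- The iterates `θ_0 = 0, θ_1, …, θ_n` of DP-GD on the dataset `D`, for the realization `b` of the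
noise. The entries with index `k : Fin n` of `η`, `σ`, `D`, `b` are those of the iteration which
leads from `θ_k` to `θ_{k+1}`. -/
noncomputable def iterate {d n : ℕ} (η : Fin n → ℝ) (C : ℝ) (σ : Fin n → ℝ)
    (D : Fin n → EuclideanSpace ℝ (Fin d) × ℝ) (b : Fin n → EuclideanSpace ℝ (Fin d)) :
    Fin (n + 1) → EuclideanSpace ℝ (Fin d) :=
  Fin.induction 0 (fun k θ => step (η k) C (σ k) (D k) θ (b k))

/-- One-pass DP-GD as a randomized algorithm: the law of the final parameter `θ_n` when the noise
vectors are independent standard Gaussians. -/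
noncomputable def dpgd {d n : ℕ} (η : Fin n → ℝ) (C : ℝ) (σ : Fin n → ℝ)
    (D : Fin n → EuclideanSpace ℝ (Fin d) × ℝ) : Measure (EuclideanSpace ℝ (Fin d)) :=
  (Measure.pi fun _ : Fin n => stdGaussian (EuclideanSpace ℝ (Fin d))).map
    (fun b => iterate η C σ D b (Fin.last n))

/-- The iterates are measurable functions of the noise, so that `dpgd` is the law of `θ_n`. -/
theorem measurable_iterate {d n : ℕ} (η : Fin n → ℝ) (C : ℝ) (σ : Fin n → ℝ)
    (D : Fin n → EuclideanSpace ℝ (Fin d) × ℝ) (k : Fin (n + 1)) :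
    Measurable fun b : Fin n → EuclideanSpace ℝ (Fin d) => iterate η C σ D b k := by
  induction k using Fin.induction with
  | zero => exact measurable_const
  | succ k ih =>
    simp only [iterate, Fin.induction_succ, step, clip, grad] at ih ⊢
    have h : Measurable fun b : Fin n → EuclideanSpace ℝ (Fin d) => b k := measurable_pi_apply k
    fun_prop

instance isProbabilityMeasure_dpgd {d n : ℕ} (η : Fin n → ℝ) (C : ℝ) (σ : Fin n → ℝ)
    (D : Fin n → EuclideanSpace ℝ (Fin d) × ℝ) : IsProbabilityMeasure (dpgd η C σ D) :=
  Measure.isProbabilityMeasure_map (measurable_iterate η C σ D (Fin.last n)).aemeasurable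

end DPGD

namespace DPGD

open MeasureTheory ProbabilityTheory
open scoped ENNReal

/-! This is privacy amplification by iteration. Let the datasets differ at sample `i`, and let `S`
be the noise variance from iteration `i` on. Before iteration `i` the two runs coincide under the
same noise. Iteration `i` separates them by at most `2 C η i`, by clipping. No later drift increases
the distance: clipping a multiple of `x` clamps its coefficient, and the rate is at most `2 / ‖x‖²`
(`norm_drift_sub_drift_le`). Shifting the noise of the second run at each `j ≥ i` absorbs the share
`σ j ^ 2 / S` of the initial gap, so the runs meet at the end. The shifts have norm at most `η i *
|σ j| / S`, and their squares sum to `η i ^ 2 / S`.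

To add up these costs, the Rényi bound is replaced by the inequality `∫ g^(1-1/α) dμ ≤ e^((α-1)A/2)
(∫ g dν)^(1-1/α)` for all `g ≥ 0`. A Gaussian shift by `h` satisfies it with `A = ‖h‖²`, and it
composes along the iterations (`lintegral_dpgd_rpow_le`), even when the shifts depend on the current
iterates. -/

/-! ### Rényi divergence by duality -/

/-- A power-type domination of `μ` by `ν`, dual to a bound on `∫ (dμ/dν)^α dν`, bounds the Rényi
divergence. -/
theorem renyiDiv_le_of_lintegral_rpow_le {Θ : Type*} [MeasurableSpace Θ] {μ ν : Measure Θ}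
    [IsProbabilityMeasure μ] [IsProbabilityMeasure ν] {α A : ℝ} (hα : 1 < α)
    (h : ∀ g : Θ → ℝ≥0∞, Measurable g →
      ∫⁻ t, g t ^ (1 - 1 / α) ∂μ ≤
        ENNReal.ofReal (Real.exp ((α - 1) / 2 * A)) * (∫⁻ t, g t ∂ν) ^ (1 - 1 / α)) :
    renyiDiv α μ ν ≤ ((α * A / 2 : ℝ) : EReal) := by
  have hα0 : 0 < α := by linarith
  have hs : 0 < 1 - 1 / α := by
    rw [sub_pos, div_lt_one hα0]; exact hα
  have hac : μ ≪ ν := by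
    refine Measure.AbsolutelyContinuous.mk fun t ht h0 => ?_
    have := h (t.indicator 1) (measurable_one.indicator ht)
    have e : (fun x => (t.indicator (1 : Θ → ℝ≥0∞) x) ^ (1 - 1 / α)) = t.indicator 1 := by
      ext x
      by_cases hx : x ∈ t <;> simp [hx, -one_div, hs]
    rw [e, lintegral_indicator_one ht, lintegral_indicator_one ht, h0,
      ENNReal.zero_rpow_of_pos hs, mul_zero] at this
    exact le_antisymm this zero_le
  set ρ := μ.rnDeriv ν with hρ
  have hρm : Measurable ρ := Measure.measurable_rnDeriv μ ν
  -- The optimal test function is `ρ ^ α`; truncation makes its integral finite, so that a power of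
  -- it can be cancelled.
  have key : ∀ N : ℕ, ∫⁻ t, min (ρ t) N ^ α ∂ν ≤
      ENNReal.ofReal (Real.exp ((α - 1) / 2 * A)) ^ α := by
    intro N
    have hm : Measurable fun t => min (ρ t) (N : ℝ≥0∞) := hρm.min measurable_const
    have h1 := h (fun t => min (ρ t) N ^ α) (hm.pow_const α)
    set I := ∫⁻ t, min (ρ t) N ^ α ∂ν with hI
    have hIt : I ≠ ∞ := by
      have : I ≤ ∫⁻ _, (N : ℝ≥0∞) ^ α ∂ν :=
        lintegral_mono fun t => ENNReal.rpow_le_rpow (min_le_right _ _) hα0.le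
      rw [lintegral_const, measure_univ, mul_one] at this
      exact ne_top_of_le_ne_top
        (ENNReal.rpow_ne_top_of_nonneg hα0.le (ENNReal.natCast_ne_top N)) this
    have h2 : I ≤ ∫⁻ t, (min (ρ t) N ^ α) ^ (1 - 1 / α) ∂μ := by
      rw [← lintegral_rnDeriv_mul hac ((hm.pow_const α).pow_const _).aemeasurable]
      refine lintegral_mono fun t => ?_
      have : α * (1 - 1 / α) = α - 1 := by field_simp
      simp only
      rw [← ENNReal.rpow_mul, this]
      calc min (ρ t) (N : ℝ≥0∞) ^ α
          = min (ρ t) (N : ℝ≥0∞) ^ (1 + (α - 1)) := by ring_nf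
        _ = min (ρ t) (N : ℝ≥0∞) * min (ρ t) (N : ℝ≥0∞) ^ (α - 1) := by
          rw [ENNReal.rpow_add_of_nonneg _ _ zero_le_one (by linarith), ENNReal.rpow_one]
        _ ≤ ρ t * min (ρ t) (N : ℝ≥0∞) ^ (α - 1) := by gcongr; exact min_le_left _ _
    have h3 := h2.trans h1
    rcases eq_or_ne I 0 with h0 | h0
    · rw [h0]; exact zero_le
    have h4 : I = I ^ (1 / α) * I ^ (1 - 1 / α) := by
      rw [← ENNReal.rpow_add _ _ h0 hIt]; simp
    have h5 : I ^ (1 / α) ≤ ENNReal.ofReal (Real.exp ((α - 1) / 2 * A)) := by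
      refine (ENNReal.mul_le_mul_iff_left (c := I ^ (1 - 1 / α)) ?_ ?_).1 (h4 ▸ h3)
      · simp [ENNReal.rpow_eq_zero_iff, h0, hIt]
      · exact ENNReal.rpow_ne_top_of_nonneg hs.le hIt
    calc I = (I ^ (1 / α)) ^ α := by
          rw [← ENNReal.rpow_mul, one_div_mul_cancel hα0.ne', ENNReal.rpow_one]
      _ ≤ _ := ENNReal.rpow_le_rpow h5 hα0.le
  have hlim : ∫⁻ t, ρ t ^ α ∂ν ≤ ENNReal.ofReal (Real.exp (α * ((α - 1) / 2 * A))) := by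
    have e : ENNReal.ofReal (Real.exp ((α - 1) / 2 * A)) ^ α
        = ENNReal.ofReal (Real.exp (α * ((α - 1) / 2 * A))) := by
      rw [ENNReal.ofReal_rpow_of_pos (Real.exp_pos _), ← Real.exp_mul, mul_comm]
    rw [← e]
    refine le_of_tendsto' (lintegral_tendsto_of_tendsto_of_monotone
      (f := fun (N : ℕ) t => min (ρ t) (N : ℝ≥0∞) ^ α) (μ := ν)
      (fun N => ((hρm.min measurable_const).pow_const α).aemeasurable) ?_ ?_) key
    · refine Filter.Eventually.of_forall fun t N M hNM => ?_
      simp only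
      gcongr
    · refine Filter.Eventually.of_forall fun t => ?_
      have := (tendsto_const_nhds (x := ρ t)).min ENNReal.tendsto_nat_nhds_top
      rw [min_top_right] at this
      exact (ENNReal.continuous_rpow_const.tendsto _).comp this
  rw [renyiDiv, if_pos hac]
  have hlog : ENNReal.log (∫⁻ t, ρ t ^ α ∂ν) ≤ ((α * ((α - 1) / 2 * A) : ℝ) : EReal) := by
    refine (ENNReal.log_monotone hlim).trans ?_
    rw [ENNReal.log_ofReal_of_pos (Real.exp_pos _), Real.log_exp]
  calc _ ≤ ((1 / (α - 1) : ℝ) : EReal) * ((α * ((α - 1) / 2 * A) : ℝ) : EReal) := by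
        refine mul_le_mul_of_nonneg_left hlog ?_
        exact_mod_cast (by have : 0 < α - 1 := by linarith
                           positivity)
    _ = ((α * A / 2 : ℝ) : EReal) := by
        rw [← EReal.coe_mul]
        congr 1
        have : α - 1 ≠ 0 := by linarith
        field_simp

/-! ### Shifts of Gaussian noise -/

/-- Tonelli's theorem for a finite power of a measure, with one coordinate singled out. -/
theorem lintegral_pi_insertNth {n : ℕ} {E : Type*} [MeasurableSpace E] (γ : Measure E)
    [SigmaFinite γ] (i : Fin (n + 1)) {f : (Fin (n + 1) → E) → ℝ≥0∞} (hf : Measurable f) :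
    ∫⁻ x, f x ∂(Measure.pi fun _ => γ) =
      ∫⁻ y, ∫⁻ z, f (i.insertNth y z) ∂(Measure.pi fun _ : Fin n => γ) ∂γ := by
  have hp := (measurePreserving_piFinSuccAbove (fun _ : Fin (n + 1) => γ) i).symm
  have hm : Measurable fun p : E × (Fin n → E) =>
      f ((MeasurableEquiv.piFinSuccAbove (fun _ => E) i).symm p) :=
    hf.comp (MeasurableEquiv.measurable _)
  rw [← hp.lintegral_comp hf, lintegral_prod _ hm.aemeasurable]
  rfl

theorem lintegral_gaussianReal_add {f : ℝ → ℝ≥0∞} (hf : Measurable f) (h : ℝ) :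
    ∫⁻ x, f (x + h) ∂(gaussianReal 0 1) =
      ∫⁻ x, f x * ENNReal.ofReal (Real.exp (h * x - h ^ 2 / 2)) ∂(gaussianReal 0 1) := by
  have e : gaussianReal h 1 = (gaussianReal 0 1).map (· + h) := by
    rw [gaussianReal_map_add_const, zero_add]
  rw [← lintegral_map hf (measurable_add_const h), ← e,
    gaussianReal_of_var_ne_zero _ one_ne_zero, gaussianReal_of_var_ne_zero _ one_ne_zero,
    lintegral_withDensity_eq_lintegral_mul _ (measurable_gaussianPDF _ _) hf,
    lintegral_withDensity_eq_lintegral_mul _ (measurable_gaussianPDF _ _) (by fun_prop)]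
  refine lintegral_congr fun x => ?_
  have : gaussianPDF h 1 x
      = gaussianPDF 0 1 x * ENNReal.ofReal (Real.exp (h * x - h ^ 2 / 2)) := by
    rw [gaussianPDF, gaussianPDF, ← ENNReal.ofReal_mul (gaussianPDFReal_nonneg _ _ _)]
    congr 1
    simp only [gaussianPDFReal]
    rw [mul_assoc (_)⁻¹, ← Real.exp_add]
    congr 2
    simp
    ring
  simp only [Pi.mul_apply, this]
  ring

/-- Hölder with exponents `α / (α - 1)` and `α`, applied to `g ^ (1 - 1 / α)` times the density of
the shifted Gaussian, whose `α`-th moment is `exp (α (α - 1) h² / 2)`. -/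
theorem lintegral_rpow_gaussianReal_add_le {α : ℝ} (hα : 1 < α) {g : ℝ → ℝ≥0∞}
    (hg : Measurable g) (h : ℝ) :
    ∫⁻ x, g (x + h) ^ (1 - 1 / α) ∂(gaussianReal 0 1) ≤
      ENNReal.ofReal (Real.exp ((α - 1) / 2 * h ^ 2)) *
        (∫⁻ x, g x ∂(gaussianReal 0 1)) ^ (1 - 1 / α) := by
  have hα0 : 0 < α := by linarith
  have hs : 0 < 1 - 1 / α := by
    rw [sub_pos, div_lt_one hα0]; exact hα
  have hα1 : α - 1 ≠ 0 := by linarith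
  rw [lintegral_gaussianReal_add (hg.pow_const _)]
  have hpq : (1 / (1 - 1 / α)).HolderConjugate α := by
    rw [Real.holderConjugate_iff]
    refine ⟨?_, ?_⟩
    · rw [lt_div_iff₀ hs]
      have : 0 < 1 / α := by positivity
      linarith
    · simp
  have := ENNReal.lintegral_mul_le_Lp_mul_Lq (gaussianReal 0 1) hpq
    (f := fun x => g x ^ (1 - 1 / α))
    (g := fun x => ENNReal.ofReal (Real.exp (h * x - h ^ 2 / 2)))
    (hg.pow_const _).aemeasurable (by fun_prop)
  refine this.trans (le_of_eq ?_)
  rw [mul_comm]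
  congr 1
  · have e : ∀ x : ℝ, ENNReal.ofReal (Real.exp (h * x - h ^ 2 / 2)) ^ α =
        ENNReal.ofReal (Real.exp (-(α * (h ^ 2 / 2))) * Real.exp (α * h * x)) := by
      intro x
      rw [ENNReal.ofReal_rpow_of_pos (Real.exp_pos _), ← Real.exp_mul, ← Real.exp_add]
      congr 2
      ring
    simp only [e]
    rw [← ofReal_integral_eq_lintegral_ofReal
      ((integrable_exp_mul_gaussianReal (α * h)).const_mul _)
      (Filter.Eventually.of_forall fun x => by positivity), integral_const_mul]
    have hm : ∫ x, Real.exp (α * h * x) ∂(gaussianReal 0 1) = Real.exp ((α * h) ^ 2 / 2) := by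
      have := congrFun (mgf_id_gaussianReal (μ := 0) (v := 1)) (α * h)
      simpa [mgf] using this
    rw [hm, ← Real.exp_add, ENNReal.ofReal_rpow_of_pos (Real.exp_pos _), ← Real.exp_mul]
    congr 2
    field_simp
    ring
  · simp only [← ENNReal.rpow_mul]
    rw [mul_one_div_cancel hs.ne', one_div_one_div]
    simp

/-- The inequality tensorizes: the bound in the other coordinates leaves the power `1 - 1 / α` of a
function of the first one, to which the one-dimensional case applies. -/
theorem lintegral_rpow_pi_gaussianReal_add_le {α : ℝ} (hα : 1 < α) {d : ℕ}
    {g : (Fin d → ℝ) → ℝ≥0∞} (hg : Measurable g) (h : Fin d → ℝ) :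
    ∫⁻ x, g (x + h) ^ (1 - 1 / α) ∂(Measure.pi fun _ => gaussianReal 0 1) ≤
      ENNReal.ofReal (Real.exp ((α - 1) / 2 * ∑ i, h i ^ 2)) *
        (∫⁻ x, g x ∂(Measure.pi fun _ => gaussianReal 0 1)) ^ (1 - 1 / α) := by
  induction d with
  | zero =>
    have e : ∀ x, x + h = x := fun x => Subsingleton.elim _ _
    simp [lintegral_unique, -one_div, e]
  | succ d ih =>
    have hins : Measurable fun p : ℝ × (Fin d → ℝ) =>
        (Fin.insertNth (α := fun _ => ℝ) 0 p.1 p.2 : Fin (d + 1) → ℝ) :=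
      (MeasurableEquiv.piFinSuccAbove (fun _ => ℝ) 0).symm.measurable
    set G : ℝ → ℝ≥0∞ := fun y =>
      ∫⁻ z, g (Fin.insertNth 0 y z) ∂(Measure.pi fun _ : Fin d => gaussianReal 0 1) with hG
    have hGm : Measurable G := (hg.comp hins).lintegral_prod_right'
    have hadd : ∀ (y : ℝ) (z : Fin d → ℝ),
        (Fin.insertNth 0 y z : Fin (d + 1) → ℝ) + h
          = Fin.insertNth 0 (y + h 0) (z + fun i => h i.succ) := by
      intro y z
      ext i
      refine Fin.cases ?_ (fun i => ?_) i <;> simp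
    have hgh : Measurable fun x => g (x + h) := hg.comp (measurable_add_const h)
    rw [lintegral_pi_insertNth _ 0 (hgh.pow_const _),
      lintegral_pi_insertNth _ 0 hg]
    simp only [hadd]
    calc _ ≤ ∫⁻ y, ENNReal.ofReal (Real.exp ((α - 1) / 2 * ∑ i : Fin d, h i.succ ^ 2)) *
            G (y + h 0) ^ (1 - 1 / α) ∂(gaussianReal 0 1) := by
          refine lintegral_mono fun y => ?_
          exact ih (g := fun z => g (Fin.insertNth 0 (y + h 0) z))
            (hg.comp (hins.comp (measurable_const.prodMk measurable_id))) _
      _ = ENNReal.ofReal (Real.exp ((α - 1) / 2 * ∑ i : Fin d, h i.succ ^ 2)) *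
            ∫⁻ y, G (y + h 0) ^ (1 - 1 / α) ∂(gaussianReal 0 1) :=
          lintegral_const_mul _ (by fun_prop)
      _ ≤ ENNReal.ofReal (Real.exp ((α - 1) / 2 * ∑ i : Fin d, h i.succ ^ 2)) *
            (ENNReal.ofReal (Real.exp ((α - 1) / 2 * h 0 ^ 2)) *
              (∫⁻ y, G y ∂(gaussianReal 0 1)) ^ (1 - 1 / α)) := by
          gcongr
          exact lintegral_rpow_gaussianReal_add_le hα hGm _
      _ = _ := by
          rw [← mul_assoc, ← ENNReal.ofReal_mul (Real.exp_pos _).le, ← Real.exp_add,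
            Fin.sum_univ_succ]
          congr 3
          ring_nf

/-- The effect of shifting a standard Gaussian vector, in the form dual to the Rényi divergence
`α ‖h‖² / 2` between the two Gaussians. -/
theorem lintegral_rpow_stdGaussian_add_le {α : ℝ} (hα : 1 < α) {d : ℕ}
    {g : EuclideanSpace ℝ (Fin d) → ℝ≥0∞} (hg : Measurable g) (h : EuclideanSpace ℝ (Fin d)) :
    ∫⁻ x, g (x + h) ^ (1 - 1 / α) ∂(stdGaussian (EuclideanSpace ℝ (Fin d))) ≤
      ENNReal.ofReal (Real.exp ((α - 1) / 2 * ‖h‖ ^ 2)) *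
        (∫⁻ x, g x ∂(stdGaussian (EuclideanSpace ℝ (Fin d)))) ^ (1 - 1 / α) := by
  have hm : Measurable (WithLp.toLp 2 : (Fin d → ℝ) → EuclideanSpace ℝ (Fin d)) := by fun_prop
  have hgh : Measurable fun x => g (x + h) := hg.comp (measurable_add_const h)
  rw [← map_pi_eq_stdGaussian, lintegral_map (hgh.pow_const _) hm, lintegral_map hg hm,
    EuclideanSpace.real_norm_sq_eq]
  exact lintegral_rpow_pi_gaussianReal_add_le hα (hg.comp hm) h.ofLp

/-! ### Geometry of the noiseless step -/

theorem adaptiveRate_nonneg {d : ℕ} {η : ℝ} (hη : 0 ≤ η) (x : EuclideanSpace ℝ (Fin d)) :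
    0 ≤ adaptiveRate η x := by
  unfold adaptiveRate
  split_ifs
  · exact hη
  · exact le_min hη (by positivity)

theorem adaptiveRate_le {d : ℕ} (η : ℝ) (x : EuclideanSpace ℝ (Fin d)) :
    adaptiveRate η x ≤ η := by
  unfold adaptiveRate
  split_ifs
  · exact le_rfl
  · exact min_le_left _ _

theorem adaptiveRate_mul_norm_sq_le {d : ℕ} (η : ℝ) (x : EuclideanSpace ℝ (Fin d)) :
    adaptiveRate η x * ‖x‖ ^ 2 ≤ 2 := by
  unfold adaptiveRate
  split_ifs with h
  · simp [h]
  · have : 0 < ‖x‖ ^ 2 := by positivity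
    calc _ ≤ 2 / ‖x‖ ^ 2 * ‖x‖ ^ 2 := by gcongr; exact min_le_right _ _
      _ = 2 := by field_simp

theorem norm_clip_le {d : ℕ} {C : ℝ} (hC : 0 < C) (g : EuclideanSpace ℝ (Fin d)) :
    ‖clip C g‖ ≤ C := by
  unfold clip
  rcases eq_or_ne g 0 with rfl | hg
  · simpa using hC.le
  have : 0 < ‖g‖ := norm_pos_iff.2 hg
  rw [norm_smul, Real.norm_of_nonneg (by positivity)]
  calc _ ≤ C / ‖g‖ * ‖g‖ := by gcongr; exact min_le_right _ _
    _ = C := by field_simp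

theorem clip_smul {d : ℕ} {C : ℝ} (hC : 0 < C) {x : EuclideanSpace ℝ (Fin d)} (hx : x ≠ 0)
    (u : ℝ) : clip C (u • x) = max (-(C / ‖x‖)) (min u (C / ‖x‖)) • x := by
  have hx' : 0 < ‖x‖ := norm_pos_iff.2 hx
  have hc : 0 < C / ‖x‖ := by positivity
  rw [clip, smul_smul]
  congr 1
  rw [norm_smul, Real.norm_eq_abs, mul_comm |u|, ← div_div]
  set c := C / ‖x‖
  rcases lt_trichotomy u 0 with hu | hu | hu
  · rw [abs_of_neg hu, min_eq_left (by linarith : u ≤ c)]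
    rcases le_total (-c) u with h | h
    · rw [max_eq_right h, min_eq_left ((one_le_div (by linarith)).2 (by linarith)), one_mul]
    · rw [max_eq_left h, min_eq_right ((div_le_one (by linarith)).2 (by linarith))]
      have := hu.ne
      field_simp
  · subst hu
    rw [min_eq_left hc.le, max_eq_right (by linarith), mul_zero]
  · rw [abs_of_pos hu]
    rcases le_total u c with h | h
    · rw [min_eq_left h, max_eq_right (by linarith), min_eq_left ((one_le_div hu).2 h), one_mul]
    · rw [min_eq_right h, max_eq_right (by linarith), min_eq_right ((div_le_one hu).2 h)]
      field_simp

/-- Projection onto an interval is firmly nonexpansive. -/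
theorem sq_max_min_sub_le {c : ℝ} (hc : 0 ≤ c) (u v : ℝ) :
    (max (-c) (min u c) - max (-c) (min v c)) ^ 2 ≤
      (max (-c) (min u c) - max (-c) (min v c)) * (u - v) := by
  have key : ∀ t, (t ≤ -c ∧ max (-c) (min t c) = -c) ∨
      (-c ≤ t ∧ t ≤ c ∧ max (-c) (min t c) = t) ∨ (c ≤ t ∧ max (-c) (min t c) = c) := by
    intro t
    grind
  rcases key u with ⟨h1, e1⟩ | ⟨h1, h1', e1⟩ | ⟨h1, e1⟩ <;>
  rcases key v with ⟨h2, e2⟩ | ⟨h2, h2', e2⟩ | ⟨h2, e2⟩ <;> rw [e1, e2] <;> nlinarith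

/-- The noiseless part of an iteration of DP-GD. -/
noncomputable def drift {d : ℕ} (η C : ℝ) (s : EuclideanSpace ℝ (Fin d) × ℝ)
    (θ : EuclideanSpace ℝ (Fin d)) : EuclideanSpace ℝ (Fin d) :=
  θ - adaptiveRate η s.1 • clip C (grad s.1 s.2 θ)

/-- With `w = θ - ω`, rate `a` and clamped coefficients `p`, `q`, expand `‖w - a (p - q) x‖²`. Firm
nonexpansiveness gives `(p - q)² ≤ (p - q) ⟨x, w⟩`, so `a ‖x‖² ≤ 2` lets the cross term pay for the
quadratic one. -/
theorem norm_drift_sub_drift_le {d : ℕ} {η C : ℝ} (hη : 0 ≤ η) (hC : 0 < C)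
    (s : EuclideanSpace ℝ (Fin d) × ℝ) (θ ω : EuclideanSpace ℝ (Fin d)) :
    ‖drift η C s θ - drift η C s ω‖ ≤ ‖θ - ω‖ := by
  obtain ⟨x, y⟩ := s
  rcases eq_or_ne x 0 with rfl | hx
  · simp [drift, grad, clip]
  simp only [drift, grad, clip_smul hC hx, smul_smul]
  have hψ := sq_max_min_sub_le (c := C / ‖x‖) (by positivity) (inner ℝ x θ - y) (inner ℝ x ω - y)
  have h0 := adaptiveRate_nonneg hη x
  have h2 := adaptiveRate_mul_norm_sq_le η x
  set a := adaptiveRate η x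
  set p := max (-(C / ‖x‖)) (min (inner ℝ x θ - y) (C / ‖x‖))
  set q := max (-(C / ‖x‖)) (min (inner ℝ x ω - y) (C / ‖x‖))
  have e : θ - (a * p) • x - (ω - (a * q) • x) = (θ - ω) - (a * (p - q)) • x := by module
  have hi : inner ℝ x θ - y - (inner ℝ x ω - y) = inner ℝ x (θ - ω) := by
    rw [inner_sub_right]; ring
  rw [hi] at hψ
  rw [e, ← abs_of_nonneg (norm_nonneg (θ - ω)), ← abs_of_nonneg (norm_nonneg (_ - _ • x)),
    ← sq_le_sq, norm_sub_sq_real, inner_smul_right, norm_smul, mul_pow, Real.norm_eq_abs,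
    sq_abs, real_inner_comm]
  have h3 : a * ‖x‖ ^ 2 * (p - q) ^ 2 ≤ 2 * (p - q) ^ 2 :=
    mul_le_mul_of_nonneg_right h2 (sq_nonneg _)
  nlinarith [mul_le_mul_of_nonneg_left h3 h0, mul_le_mul_of_nonneg_left hψ h0]

theorem norm_drift_sub_drift_le_of_rate {d : ℕ} {η C : ℝ} (hη : 0 ≤ η) (hC : 0 < C)
    (s s' : EuclideanSpace ℝ (Fin d) × ℝ) (θ : EuclideanSpace ℝ (Fin d)) :
    ‖drift η C s θ - drift η C s' θ‖ ≤ 2 * C * η := by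
  have key : ∀ s : EuclideanSpace ℝ (Fin d) × ℝ,
      ‖adaptiveRate η s.1 • clip C (grad s.1 s.2 θ)‖ ≤ η * C := by
    intro s
    rw [norm_smul, Real.norm_of_nonneg (adaptiveRate_nonneg hη _)]
    exact mul_le_mul (adaptiveRate_le _ _) (norm_clip_le hC _) (norm_nonneg _) hη
  simp only [drift]
  rw [sub_sub_sub_cancel_left]
  refine (norm_sub_le _ _).trans ?_
  linarith [key s, key s']

@[fun_prop]
theorem measurable_drift {d : ℕ} (η C : ℝ) (s : EuclideanSpace ℝ (Fin d) × ℝ) :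
    Measurable (drift η C s) := by
  unfold drift clip grad
  fun_prop

/-! ### Propagating a discrepancy through the iterations -/

/-- Part of a discrepancy `v` can be absorbed by a shift of the noise, in proportion to the share
of the present noise in the variance still to come. -/
theorem exists_split_of_norm_le {E : Type*} [NormedAddCommGroup E] [NormedSpace ℝ E]
    {C η σ S T T' : ℝ} (hC : 0 < C) (hT' : 0 ≤ T') (hT : T = σ ^ 2 + T')
    {v : E} (hv : ‖v‖ ≤ 2 * C * η * T / S) (hη : 0 ≤ η) (hS : 0 ≤ S) :
    ∃ u h : E, v = u + (2 * C * σ) • h ∧ ‖u‖ ≤ 2 * C * η * T' / S ∧ ‖h‖ ≤ η * |σ| / S := by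
  have hT0 : 0 ≤ T := by rw [hT]; positivity
  rcases hT0.eq_or_lt with h0 | h0
  · have : v = 0 := by
      rw [← norm_le_zero_iff]
      simpa [← h0] using hv
    exact ⟨0, 0, by simp [this], by simp; positivity, by simp; positivity⟩
  refine ⟨(T' / T) • v, (σ / (2 * C * T)) • v, ?_, ?_, ?_⟩
  · rw [smul_smul, ← add_smul]
    have : T' / T + 2 * C * σ * (σ / (2 * C * T)) = 1 := by
      field_simp
      linarith
    rw [this, one_smul]
  · rw [norm_smul, Real.norm_of_nonneg (by positivity)]
    calc _ ≤ T' / T * (2 * C * η * T / S) := by gcongr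
      _ = _ := by field_simp
  · rw [norm_smul, Real.norm_eq_abs, abs_div, abs_of_pos (by positivity : 0 < 2 * C * T)]
    calc _ ≤ |σ| / (2 * C * T) * (2 * C * η * T / S) := by gcongr
      _ = _ := by field_simp

theorem step_eq_drift_add {d : ℕ} (η C σ : ℝ) (s : EuclideanSpace ℝ (Fin d) × ℝ)
    (θ b : EuclideanSpace ℝ (Fin d)) :
    step η C σ s θ b = drift η C s θ + (2 * C * σ) • b := rfl

theorem iterate_castSucc {d n : ℕ} (η : Fin (n + 1) → ℝ) (C : ℝ) (σ : Fin (n + 1) → ℝ)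
    (D : Fin (n + 1) → EuclideanSpace ℝ (Fin d) × ℝ)
    (b : Fin (n + 1) → EuclideanSpace ℝ (Fin d)) (k : Fin (n + 1)) :
    iterate η C σ D b k.castSucc =
      iterate (fun j => η j.castSucc) C (fun j => σ j.castSucc) (fun j => D j.castSucc)
        (fun j => b j.castSucc) k := by
  induction k using Fin.induction with
  | zero => rfl
  | succ k ih =>
    have e : k.succ.castSucc = k.castSucc.succ := rfl
    simp only [e, iterate, Fin.induction_succ] at ih ⊢
    rw [ih]

theorem lintegral_dpgd_zero {d : ℕ} (η : Fin 0 → ℝ) (C : ℝ) (σ : Fin 0 → ℝ)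
    (D : Fin 0 → EuclideanSpace ℝ (Fin d) × ℝ) {f : EuclideanSpace ℝ (Fin d) → ℝ≥0∞}
    (hf : Measurable f) : ∫⁻ θ, f θ ∂(dpgd η C σ D) = f 0 := by
  rw [dpgd, lintegral_map hf (measurable_iterate _ _ _ _ _), lintegral_unique, measure_univ,
    mul_one]
  rfl

theorem lintegral_dpgd_succ {d n : ℕ} (η : Fin (n + 1) → ℝ) (C : ℝ) (σ : Fin (n + 1) → ℝ)
    (D : Fin (n + 1) → EuclideanSpace ℝ (Fin d) × ℝ) {f : EuclideanSpace ℝ (Fin d) → ℝ≥0∞}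
    (hf : Measurable f) :
    ∫⁻ θ, f θ ∂(dpgd η C σ D) =
      ∫⁻ θ, ∫⁻ b, f (drift (η (Fin.last n)) C (D (Fin.last n)) θ + (2 * C * σ (Fin.last n)) • b)
          ∂(stdGaussian (EuclideanSpace ℝ (Fin d)))
        ∂(dpgd (fun j => η j.castSucc) C (fun j => σ j.castSucc) (fun j => D j.castSucc)) := by
  have hm := measurable_iterate (fun j => η j.castSucc) C (fun j => σ j.castSucc)
    (fun j => D j.castSucc) (Fin.last n)
  have hfm : Measurable fun b => f (iterate η C σ D b (Fin.last (n + 1))) :=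
    hf.comp (measurable_iterate _ _ _ _ _)
  rw [dpgd, lintegral_map hf (measurable_iterate _ _ _ _ _),
    lintegral_pi_insertNth _ (Fin.last n) hfm,
    dpgd, lintegral_map ?_ hm]
  · have e : ∀ (y : EuclideanSpace ℝ (Fin d)) (z : Fin n → EuclideanSpace ℝ (Fin d)),
        iterate η C σ D ((Fin.last n).insertNth y z) (Fin.last (n + 1)) =
          drift (η (Fin.last n)) C (D (Fin.last n))
            (iterate (fun j => η j.castSucc) C (fun j => σ j.castSucc) (fun j => D j.castSucc)
              z (Fin.last n)) + (2 * C * σ (Fin.last n)) • y := by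
      intro y z
      have e1 : ∀ b, iterate η C σ D b (Fin.last (n + 1)) =
          step (η (Fin.last n)) C (σ (Fin.last n)) (D (Fin.last n))
            (iterate η C σ D b (Fin.last n).castSucc) (b (Fin.last n)) := fun b => by
        rw [← Fin.succ_last]
        simp only [iterate, Fin.induction_succ]
      rw [e1, iterate_castSucc, step_eq_drift_add]
      simp
    simp only [e]
    rw [lintegral_lintegral_swap]
    refine Measurable.aemeasurable ?_
    unfold Function.uncurry
    fun_prop
  · refine Measurable.lintegral_prod_right'
      (f := fun p : EuclideanSpace ℝ (Fin d) × EuclideanSpace ℝ (Fin d) =>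
        f (drift (η (Fin.last n)) C (D (Fin.last n)) p.1 + (2 * C * σ (Fin.last n)) • p.2)) ?_
    fun_prop

/-- If a discrepancy `r j` before iteration `j` of two runs of DP-GD can be reduced to `r (j + 1)`
by a shift of the noise of norm at most `a j`, then a domination of a function by another one at
distance `r n` passes to the expectations over the outputs of the runs. -/
theorem lintegral_dpgd_rpow_le {α : ℝ} (hα : 1 < α) {d n : ℕ} (η : Fin n → ℝ) (C : ℝ)
    (σ : Fin n → ℝ) (D D' : Fin n → EuclideanSpace ℝ (Fin d) × ℝ) (r : Fin (n + 1) → ℝ)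
    (a : Fin n → ℝ) (hr : 0 ≤ r 0)
    (hstep : ∀ j θ ω, ‖θ - ω‖ ≤ r j.castSucc → ∃ u h : EuclideanSpace ℝ (Fin d),
      drift (η j) C (D j) θ - drift (η j) C (D' j) ω = u + (2 * C * σ j) • h ∧
        ‖u‖ ≤ r j.succ ∧ ‖h‖ ≤ a j)
    {f g : EuclideanSpace ℝ (Fin d) → ℝ≥0∞} (hf : Measurable f) (hg : Measurable g) {K : ℝ≥0∞}
    (hfg : ∀ θ ω, ‖θ - ω‖ ≤ r (Fin.last n) → f θ ≤ K * g ω ^ (1 - 1 / α)) :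
    ∫⁻ θ, f θ ∂(dpgd η C σ D) ≤
      K * ENNReal.ofReal (Real.exp ((α - 1) / 2 * ∑ j, a j ^ 2)) *
        (∫⁻ ω, g ω ∂(dpgd η C σ D')) ^ (1 - 1 / α) := by
  induction n generalizing f g K with
  | zero =>
    rw [lintegral_dpgd_zero _ _ _ _ hf, lintegral_dpgd_zero _ _ _ _ hg]
    simpa using hfg 0 0 (by simpa using hr)
  | succ n ih =>
    have hmeas : ∀ (s : EuclideanSpace ℝ (Fin d) × ℝ) {f : EuclideanSpace ℝ (Fin d) → ℝ≥0∞},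
        Measurable f → Measurable fun θ => ∫⁻ b,
          f (drift (η (Fin.last n)) C s θ + (2 * C * σ (Fin.last n)) • b)
            ∂(stdGaussian (EuclideanSpace ℝ (Fin d))) := by
      intro s f hf
      refine Measurable.lintegral_prod_right'
        (f := fun p : EuclideanSpace ℝ (Fin d) × EuclideanSpace ℝ (Fin d) =>
          f (drift (η (Fin.last n)) C s p.1 + (2 * C * σ (Fin.last n)) • p.2)) ?_
      fun_prop
    rw [lintegral_dpgd_succ _ _ _ _ hf, lintegral_dpgd_succ _ _ _ _ hg]
    refine (ih (fun j => η j.castSucc) (fun j => σ j.castSucc) (fun j => D j.castSucc)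
      (fun j => D' j.castSucc) (fun j => r j.castSucc) (fun j => a j.castSucc) hr
      (fun j => hstep j.castSucc) (hmeas _ hf) (hmeas (D' (Fin.last n)) hg)
      (K := K * ENNReal.ofReal (Real.exp ((α - 1) / 2 * a (Fin.last n) ^ 2))) ?_).trans_eq ?_
    · intro θ ω hθ
      obtain ⟨u, h, huh, hu, hh⟩ := hstep (Fin.last n) θ ω hθ
      set c := 2 * C * σ (Fin.last n)
      have hG : Measurable fun b => g (drift (η (Fin.last n)) C (D' (Fin.last n)) ω + c • b) := by
        fun_prop
      -- Noise `b` in the first run is coupled with `b + h` in the second, which leaves exactly the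
      -- discrepancy `u`.
      calc _ ≤ ∫⁻ b, K * g (drift (η (Fin.last n)) C (D' (Fin.last n)) ω + c • (b + h)) ^
                (1 - 1 / α) ∂(stdGaussian (EuclideanSpace ℝ (Fin d))) := by
            refine lintegral_mono fun b => hfg _ _ ?_
            have : drift (η (Fin.last n)) C (D (Fin.last n)) θ + c • b -
                (drift (η (Fin.last n)) C (D' (Fin.last n)) ω + c • (b + h)) = u := by
              rw [eq_add_of_sub_eq huh]
              module
            rw [this]
            exact hu
        _ = K * ∫⁻ b, g (drift (η (Fin.last n)) C (D' (Fin.last n)) ω + c • (b + h)) ^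
                (1 - 1 / α) ∂(stdGaussian (EuclideanSpace ℝ (Fin d))) :=
            lintegral_const_mul _ (by fun_prop)
        _ ≤ K * (ENNReal.ofReal (Real.exp ((α - 1) / 2 * ‖h‖ ^ 2)) *
              (∫⁻ b, g (drift (η (Fin.last n)) C (D' (Fin.last n)) ω + c • b)
                ∂(stdGaussian (EuclideanSpace ℝ (Fin d)))) ^ (1 - 1 / α)) := by
            gcongr
            exact lintegral_rpow_stdGaussian_add_le hα hG h
        _ ≤ _ := by
            rw [← mul_assoc]
            have : 0 ≤ (α - 1) / 2 := by linarith
            gcongr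
    · rw [mul_assoc K, ← ENNReal.ofReal_mul (Real.exp_pos _).le, ← Real.exp_add,
        Fin.sum_univ_castSucc]
      congr 4
      ring


/-! ### Choice of the shifts and conclusion -/

theorem isZCDP_dpgd {d n : ℕ} (η : Fin n → ℝ) (C : ℝ) (σ : Fin n → ℝ)
    (hη : ∀ k, 0 ≤ η k) (hC : 0 < C)
    (hσ : ∀ k, η k ≠ 0 → ∑ j ∈ Finset.Ici k, σ j ^ 2 ≠ 0) :
    IsZCDP (fun D : Fin n → EuclideanSpace ℝ (Fin d) × ℝ => dpgd η C σ D)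
      ((⨆ k, η k / √(∑ j ∈ Finset.Ici k, σ j ^ 2)) ^ 2 / 2) := by
  rintro D D' ⟨i, hi⟩ α hα
  have hα0 : 0 < α := by linarith
  -- Tail variances are indexed by `ℕ` to include the empty tail `T n = 0`, which forces the runs to
  -- meet.
  set T : ℕ → ℝ := fun m => ∑ l ∈ Finset.univ.filter fun l : Fin n => m ≤ l, σ l ^ 2 with hTdef
  have hT0 : ∀ m, 0 ≤ T m := fun m => Finset.sum_nonneg fun l _ => sq_nonneg _
  have hTs : ∀ j : Fin n, T j = σ j ^ 2 + T (j + 1) := by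
    intro j
    have : Finset.univ.filter (fun l : Fin n => (j : ℕ) ≤ l) =
        insert j (Finset.univ.filter fun l : Fin n => (j : ℕ) + 1 ≤ l) := by
      ext l
      simp only [Finset.mem_filter, Finset.mem_insert, Finset.mem_univ, true_and, Fin.ext_iff]
      omega
    simp only [hTdef]
    rw [this, Finset.sum_insert (by simp)]
  have hTi : ∀ k : Fin n, ∑ j ∈ Finset.Ici k, σ j ^ 2 = T k := by
    intro k
    simp only [hTdef]
    congr 1
    ext l
    simp
  have hTn : T n = 0 := by
    simp only [hTdef]
    rw [Finset.filter_false_of_mem (fun l _ => by omega), Finset.sum_empty]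
  set S := T i with hS
  -- If `S = 0`, then `hσ` forces `η i = 0`, and both sides vanish.
  have hηS : 2 * C * η i ≤ 2 * C * η i * S / S := by
    rcases eq_or_ne (η i) 0 with h | h
    · simp [h]
    · have : S ≠ 0 := by
        rw [hS, ← hTi]
        exact hσ i h
      rw [mul_div_cancel_right₀ _ this]
  set r : Fin (n + 1) → ℝ := fun j =>
    if (j : ℕ) ≤ i then 0 else 2 * C * η i * T j / S with hr
  set a : Fin n → ℝ := fun j => if i ≤ j then η i * |σ j| / S else 0 with ha
  have hstep : ∀ j θ ω, ‖θ - ω‖ ≤ r j.castSucc → ∃ u h : EuclideanSpace ℝ (Fin d),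
      drift (η j) C (D j) θ - drift (η j) C (D' j) ω = u + (2 * C * σ j) • h ∧
        ‖u‖ ≤ r j.succ ∧ ‖h‖ ≤ a j := by
    intro j θ ω hθ
    rcases lt_or_ge j i with hji | hji
    · have h1 : (j : ℕ) < i := hji
      simp only [hr, Fin.val_castSucc, if_pos h1.le, norm_le_zero_iff, sub_eq_zero] at hθ
      refine ⟨0, 0, ?_, ?_, ?_⟩
      · rw [hi j hji.ne, hθ]; simp
      · simp [hr, hji]
      · simp [ha, hji.not_ge]
    · have h1 : (i : ℕ) ≤ j := hji
      have hv : ‖drift (η j) C (D j) θ - drift (η j) C (D' j) ω‖ ≤ 2 * C * η i * T j / S := by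
        rcases hji.eq_or_lt with rfl | hlt
        · simp only [hr, Fin.val_castSucc, le_refl, if_true, norm_le_zero_iff,
            sub_eq_zero] at hθ
          rw [hθ]
          exact (norm_drift_sub_drift_le_of_rate (hη i) hC _ _ _).trans hηS
        · have h2 : ¬ ((j : ℕ) ≤ i) := not_le.2 hlt
          rw [hi j hlt.ne']
          simp only [hr, Fin.val_castSucc, if_neg h2] at hθ
          exact (norm_drift_sub_drift_le (hη j) hC _ _ _).trans hθ
      obtain ⟨u, h, e, hu, hh⟩ :=
        exists_split_of_norm_le hC (hT0 (j + 1)) (hTs j) hv (hη i) (hT0 i)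
      refine ⟨u, h, e, ?_, ?_⟩
      · have h3 : ¬ ((j : ℕ) + 1 ≤ i) := by omega
        simpa only [hr, Fin.val_succ, if_neg h3] using hu
      · simpa only [ha, if_pos hji] using hh
  have hrn : r (Fin.last n) = 0 := by simp [hr, hTn]
  have hA : ∑ j, a j ^ 2 ≤ (⨆ k, η k / √(∑ j ∈ Finset.Ici k, σ j ^ 2)) ^ 2 := by
    have e : ∑ j, a j ^ 2 = (η i / √(∑ j ∈ Finset.Ici i, σ j ^ 2)) ^ 2 := by
      have e1 : ∀ j, a j ^ 2 = if i ≤ j then η i ^ 2 / S ^ 2 * σ j ^ 2 else 0 := by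
        intro j
        simp only [ha]
        split_ifs
        · rw [div_pow, mul_pow, sq_abs]; ring
        · simp
      have e2 : ∑ j : Fin n with i ≤ j, σ j ^ 2 = S := rfl
      rw [Finset.sum_congr rfl fun j _ => e1 j, ← Finset.sum_filter, ← Finset.mul_sum, e2, hTi,
        div_pow, Real.sq_sqrt (hT0 i)]
      change η i ^ 2 / S ^ 2 * S = η i ^ 2 / S
      rcases eq_or_ne S 0 with h | h
      · simp [h]
      · field_simp
    rw [e]
    refine pow_le_pow_left₀ (div_nonneg (hη i) (Real.sqrt_nonneg _)) ?_ 2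
    exact le_ciSup (f := fun k => η k / √(∑ j ∈ Finset.Ici k, σ j ^ 2))
      (Set.finite_range _).bddAbove i
  refine (renyiDiv_le_of_lintegral_rpow_le (A := ∑ j, a j ^ 2) hα fun g hg => ?_).trans ?_
  · have := lintegral_dpgd_rpow_le hα η C σ D D' r a (by simp [hr]) hstep
      (hg.pow_const (1 - 1 / α)) hg (K := 1) (fun θ ω h => ?_)
    · simpa only [one_mul] using this
    · rw [hrn, norm_le_zero_iff, sub_eq_zero] at h
      rw [h, one_mul]
  · rw [EReal.coe_le_coe_iff]
    nlinarith

end DPGD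

/-- The final output of one-pass DP-GD is `ρ² / 2`-zCDP with
`ρ = max_k η_k / √(∑_{j ≥ k} σ_j²)`. The hypothesis `hσ` says that no quotient is infinite; where
`η_k` and the denominator both vanish, the quotient is `0`. -/
theorem proposition4p1 {d n : ℕ} (η : Fin n → ℝ) (C : ℝ) (σ : Fin n → ℝ)
    (hη : ∀ k, 0 ≤ η k) (hC : 0 < C)
    (hσ : ∀ k, η k ≠ 0 → ∑ j ∈ Finset.Ici k, σ j ^ 2 ≠ 0) :
    DPGD.IsZCDP (fun D : Fin n → EuclideanSpace ℝ (Fin d) × ℝ => DPGD.dpgd η C σ D)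
      ((⨆ k, η k / √(∑ j ∈ Finset.Ici k, σ j ^ 2)) ^ 2 / 2) :=
  DPGD.isZCDP_dpgd η C σ hη hC hσ
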